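/- Let $E$ be a finite set and let $X=(X_t)_{t\ge 0}$ be a right-continuous, time-homogeneous continuous-time Markov chain on $E$ with laws $(\mathbb P_x)_{x\in E}$, $\mathbb P_x(X_0=x)=1$, and Markov generator $\mathcal Q=(Q(x,y))_{x,y\in E}$. Let $\beta>0$ and let $\psi,\phi:E\to\mathbb R$ satisfy $0\le\psi\le\phi$. For stopping times $\tau,\gamma$ (with values in $[0,\infty]$) of the natural filtration of $X$ put $$R_x(\tau,\gamma)=\mathbb E_x\big[e^{-\beta\tau}\psi(X_\tau)\mathbf 1_{\tau\le\gamma}+e^{-\beta\gamma}\phi(X_\gamma)\mathbf 1_{\tau>\gamma}\big],$$ where $e^{-\beta\eta}f(X_\eta)=0$ on $\{\eta=\infty\}$. The game with payoffs $(\psi,\phi)$ has a value if $\sup_\tau\inf_\gamma R_x(\tau,\gamma)=\inf_\gamma\sup_\tau R_x(\tau,\gamma)$ for all $x\in E$; the common function of $x$ is then its value function. A pair $(\tau^*,\gamma^*)$ of stopping times is a Nash equilibrium if $R_x(\tau,\gamma^*)\le R_x(\tau^*,\gamma^*)\le R_x(\tau^*,\gamma)$ for all $x\in E$ and all stopping times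 $\tau,\gamma$. For $A\subset E$ let $h(A)=\inf\{t\ge0: X_t\in A\}$. The game with payoffs $(\psi,\phi)$ has a value; let $V$ be its value function. Let $I$ be any subset of $\{\psi<V<\phi\}$ and define $\phi_c=V$ on $I$ and $\phi_c=\phi$ on $E\setminus I$. Then the game with payoffs $(\psi,\phi_c)$ (that is, with $\phi$ replaced by $\phi_c$ in $R_x$) has a value, and its value function $V_c$ satisfies $V_c=V$. If moreover $\psi(x)<\phi(x)$ for all $x\in E$, then both $\big(h(\{V=\psi\}),h(\{V=\phi\})\big)$ and $\big(h(\{V=\psi\}),h(\{V=\phi\}\cup I)\big)$ are Nash equilibria of the game with payoffs $(\psi,\phi_c)$, and for every $x\in I$ one has $h(\{V=\phi\}\cup I)<h(\{V=\phi\})$ $\mathbb P_x$-almost surely; so the two equilibria are different whenever $I\ne\emptyset$. -/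

import Mathlib

open MeasureTheory Set
open scoped NNReal Topology

noncomputable section

/-- A Markov generator on a finite set: rows sum to zero, off-diagonal entries are nonnegative. -/
structure IsMarkovGenerator {E : Type*} [Fintype E] (Q : Matrix E E ℝ) : Prop where
  row_sum : ∀ x, ∑ y, Q x y = 0
  off_diag_nonneg : ∀ x y, x ≠ y → 0 ≤ Q x y

/-- A right-continuous time-homogeneous continuous-time Markov chain `(X_t)_{t ≥ 0}` on a finite
(discrete) state space `E`, with its laws `(P_x)_{x ∈ E}` and its generator `Q`. -/
structure MarkovChain (E Ω : Type*) [Fintype E] [MeasurableSpace E] [DiscreteMeasurableSpace E]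
    [MeasurableSpace Ω] where
  /-- the process -/
  X : ℝ≥0 → Ω → E
  /-- the law of the chain started at `x` -/
  P : E → Measure Ω
  /-- the generator -/
  Q : Matrix E E ℝ
  measurable_X : ∀ t, Measurable (X t)
  isProbabilityMeasure_P : ∀ x, IsProbabilityMeasure (P x)
  /-- every path is right-continuous for the discrete topology of `E` -/
  rightContinuous : ∀ ω t, ∀ᶠ s in 𝓝[≥] t, X s ω = X t ω
  initial : ∀ x, P x {ω | X 0 ω = x} = 1
  /-- the Markov property with respect to the natural filtration:
  `P_x(A ∩ {X_{s+t} = y}) = E_x[1_A p_t(X_s, y)]` for `A ∈ σ(X_r, r ≤ s)`,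
  where `p_t(z, y) = P_z(X_t = y)` -/
  markov : ∀ (x : E) (s t : ℝ≥0) (A : Set Ω),
    MeasurableSet[⨆ r ≤ s, MeasurableSpace.comap (X r) inferInstance] A → ∀ y : E,
      P x (A ∩ {ω | X (s + t) ω = y}) =
        ∑ z, P x (A ∩ {ω | X s ω = z}) * P z {ω | X t ω = y}
  isMarkovGenerator : IsMarkovGenerator Q
  /-- `Q` is the right derivative at `t = 0` of the transition matrices `(P_x(X_t = y))_{x,y}` -/
  generator : ∀ x y, HasDerivWithinAt
    (fun t : ℝ => (P x).real {ω | X t.toNNReal ω = y}) (Q x y) (Ici 0) 0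

namespace MarkovChain

variable {E Ω : Type*} [Fintype E] [MeasurableSpace E] [DiscreteMeasurableSpace E]
  [mΩ : MeasurableSpace Ω] (M : MarkovChain E Ω)

/-- The natural filtration `F_t = σ(X_s, s ≤ t)`. -/
def filtration : Filtration ℝ≥0 mΩ where
  seq t := ⨆ s ≤ t, MeasurableSpace.comap (M.X s) inferInstance
  mono' _ _ h := biSup_mono fun _ hs => hs.trans h
  le' _ := iSup₂_le fun s _ => (M.measurable_X s).comap_le

/-- The set of all stopping times, with values in `[0, ∞]`, of the natural filtration. -/
def stoppingTimes : Set (Ω → WithTop ℝ≥0) := {τ | IsStoppingTime M.filtration τ}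

/-- The first hitting time `h(A) = inf {t ≥ 0 : X_t ∈ A}` (`∞` if `A` is never hit). -/
def hit (A : Set E) : Ω → WithTop ℝ≥0 := hittingAfter M.X A 0

open Classical in
/-- `e^{-β η} f(X_η)`, with the convention that it is `0` where `η = ∞`. -/
def discounted (β : ℝ) (f : E → ℝ) (η : Ω → WithTop ℝ≥0) (ω : Ω) : ℝ :=
  if η ω = ⊤ then 0
  else Real.exp (-β * ((η ω).untopD 0 : ℝ≥0)) * f (M.X ((η ω).untopD 0) ω)

open Classical in
/-- The expected payoff
`R_x(τ, γ) = E_x[e^{-β τ} ψ(X_τ) 1_{τ ≤ γ} + e^{-β γ} φ(X_γ) 1_{τ > γ}]`. -/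
def payoff (β : ℝ) (ψ φ : E → ℝ) (x : E) (τ γ : Ω → WithTop ℝ≥0) : ℝ :=
  ∫ ω, (if τ ω ≤ γ ω then M.discounted β ψ τ ω else M.discounted β φ γ ω) ∂(M.P x)

/-- The upper value `inf_γ sup_τ R_x(τ, γ)`. -/
def upperValue (β : ℝ) (ψ φ : E → ℝ) (x : E) : ℝ :=
  ⨅ γ : M.stoppingTimes, ⨆ τ : M.stoppingTimes, M.payoff β ψ φ x τ γ

/-- The lower value `sup_τ inf_γ R_x(τ, γ)`. -/
def lowerValue (β : ℝ) (ψ φ : E → ℝ) (x : E) : ℝ :=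
  ⨆ τ : M.stoppingTimes, ⨅ γ : M.stoppingTimes, M.payoff β ψ φ x τ γ

/-- `V` is the value function of the game: it is both the lower and the upper value. -/
def IsValue (β : ℝ) (ψ φ V : E → ℝ) : Prop :=
  M.lowerValue β ψ φ = V ∧ M.upperValue β ψ φ = V

/-- `(τ₀, γ₀)` is a Nash equilibrium (saddle point) of the game. -/
def IsNashEquilibrium (β : ℝ) (ψ φ : E → ℝ) (τ₀ γ₀ : Ω → WithTop ℝ≥0) : Prop :=
  τ₀ ∈ M.stoppingTimes ∧ γ₀ ∈ M.stoppingTimes ∧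
    ∀ x, ∀ τ ∈ M.stoppingTimes, ∀ γ ∈ M.stoppingTimes,
      M.payoff β ψ φ x τ γ₀ ≤ M.payoff β ψ φ x τ₀ γ₀ ∧
        M.payoff β ψ φ x τ₀ γ₀ ≤ M.payoff β ψ φ x τ₀ γ

end MarkovChain

open Classical in
/-- The modified payoff `φ_c`: equal to `V` on `I` and to `φ` off `I`. -/
def lowerOn {E : Type*} (I : Set E) (V φ : E → ℝ) (x : E) : ℝ :=
  if x ∈ I then V x else φ x

end

open Filter

/-! The value is found analytically, as a solution `V` of the double obstacle problem: `ψ ≤ V ≤ φ`,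
with `QV - βV ≤ 0` where `V < φ` and `QV - βV ≥ 0` where `ψ < V` (`exists_obstacle_solution`).
Discounted optional stopping (`integral_discounted_le`) makes `e^{-βt} V(X_t)` a supermartingale up
to `h({V = φ})` and a submartingale up to `h({V = ψ})`. Hence each of these times guarantees `V` to
its player (`payoff_hit_le`, `le_payoff_hit`), which gives value and equilibrium at once.

The argument for the maximizer only needs the upper payoff to dominate `V`; the one for the
minimizer only needs it to be at most `V` on the stopping set. Lowering `φ` to `V` on `I` preserves
both, and also makes `{V = φ} ∪ I` an admissible stopping set, whence the second equilibrium.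

Optional stopping is proved by hand: sample on a grid, bound each increment by the Markov property
and the derivative of the semigroup at `0`, then refine the grid. -/

/-! ### Elementary estimates for the time grid. -/

theorem exists_telescope_eq (G : ℕ → ℝ) (p : ℕ → Prop) [DecidablePred p]
    (hp : ∀ k l, k ≤ l → p l → p k) (K : ℕ) :
    ∃ m ≤ K, G 0 + ∑ k ∈ Finset.range K, (if p k then G (k + 1) - G k else 0) = G m ∧
      (∀ k < m, p k) ∧ (m < K → ¬ p m) := by
  induction K with
  | zero => exact ⟨0, le_rfl, by simp⟩
  | succ K ih =>
    obtain ⟨m, hmK, hsum, hlt, hm⟩ := ih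
    rw [Finset.sum_range_succ, ← add_assoc, hsum]
    by_cases hK : p K
    · have : m = K := by
        by_contra hne
        exact hm (by omega) (hp m K hmK hK)
      subst this
      refine ⟨m + 1, le_rfl, by simp [hK], fun k hk => ?_, by simp⟩
      exact hp k m (by omega) hK
    · refine ⟨m, by omega, by simp [hK], hlt, fun _ => ?_⟩
      rcases hmK.lt_or_eq with h | h
      · exact hm h
      · exact h ▸ hK

theorem eventually_sub_le_of_hasDerivWithinAt_nonpos {g : ℝ → ℝ} {d : ℝ}
    (hg : HasDerivWithinAt g d (Ici 0) 0) (hd : d ≤ 0) {ε : ℝ} (hε : 0 < ε) :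
    ∀ᶠ t in 𝓝[≥] (0 : ℝ), g t - g 0 ≤ ε * t := by
  have h := (hasDerivWithinAt_iff_isLittleO.1 hg).def hε
  filter_upwards [h, self_mem_nhdsWithin] with t ht (ht0 : 0 ≤ t)
  simp only [sub_zero, smul_eq_mul, Real.norm_eq_abs, abs_of_nonneg ht0] at ht
  nlinarith [le_abs_self (g t - g 0 - t * d), mul_nonneg ht0 (neg_nonneg.2 hd)]

/-- The bound does not depend on mesh or horizon, so errors `ε h` per step, discounted, add up to
`O(ε)`. It follows from `e^{-u} (1 + u) ≤ 1` with `u = β h`. -/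
theorem sum_exp_mul_le {β h : ℝ} (hβ : 0 < β) (hh : 0 < h) (hh1 : h ≤ 1) (K : ℕ) :
    ∑ k ∈ Finset.range K, Real.exp (-β * (k * h)) * h ≤ (1 + β) / β := by
  have hu : 0 < β * h := mul_pos hβ hh
  have hr : Real.exp (-(β * h)) * (1 + β * h) ≤ 1 := by
    rw [Real.exp_neg, inv_mul_le_iff₀ (Real.exp_pos _)]
    linarith [Real.add_one_le_exp (β * h)]
  have key : ∀ K : ℕ, β * ∑ k ∈ Finset.range K, Real.exp (-β * (k * h)) * h ≤
      (1 + β * h) * (1 - Real.exp (-β * (K * h))) := by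
    intro K
    induction K with
    | zero => simp
    | succ K ih =>
      have : Real.exp (-β * ((K + 1 : ℕ) * h)) =
          Real.exp (-β * (K * h)) * Real.exp (-(β * h)) := by
        rw [← Real.exp_add]; congr 1; push_cast; ring
      rw [Finset.sum_range_succ, this]
      nlinarith [mul_le_mul_of_nonneg_left hr (Real.exp_pos (-β * (K * h))).le]
  rw [le_div_iff₀ hβ]
  nlinarith [key K, mul_pos (show 0 < 1 + β * h by positivity) (Real.exp_pos (-β * (K * h)))]

/-! ### The double obstacle problem. -/

namespace IsMarkovGenerator

variable {E : Type*} [Fintype E] {Q : Matrix E E ℝ}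

/-- The double obstacle problem of a discounted finite-state generator has a solution. -/
theorem exists_obstacle_solution (hQ : IsMarkovGenerator Q) {β : ℝ} (hβ : 0 < β) {ψ φ : E → ℝ}
    (hψφ : ∀ x, ψ x ≤ φ x) :
    ∃ V : E → ℝ, (∀ x, ψ x ≤ V x) ∧ (∀ x, V x ≤ φ x) ∧
      (∀ x, V x < φ x → ∑ y, Q x y * V y - β * V x ≤ 0) ∧
      (∀ x, ψ x < V x → 0 ≤ ∑ y, Q x y * V y - β * V x) := by
  classical
  -- Uniformization: `c` dominates every `|Q x x|`, so `a = Q + c · id` is nonnegative with row sums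
  -- `c`. Then `W ↦ aW / (c + β)` contracts the sup norm by `c / (c + β) < 1`, and truncation
  -- between the obstacles preserves this.
  set c : ℝ := ∑ x, |Q x x| with hc
  have hc0 : 0 ≤ c := Finset.sum_nonneg fun _ _ => abs_nonneg _
  have hcβ : 0 < c + β := by positivity
  set a : E → E → ℝ := fun x y => Q x y + if x = y then c else 0 with ha
  have ha0 : ∀ x y, 0 ≤ a x y := by
    intro x y
    by_cases h : x = y
    · subst h
      have : |Q x x| ≤ c :=
        Finset.single_le_sum (f := fun x => |Q x x|) (fun _ _ => abs_nonneg _) (Finset.mem_univ x)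
      simp only [ha, if_true]
      linarith [neg_abs_le (Q x x)]
    · simpa [ha, h] using hQ.off_diag_nonneg x y h
  have ha1 : ∀ (W : E → ℝ) x, ∑ y, a x y * W y = ∑ y, Q x y * W y + c * W x := by
    intro W x
    simp [ha, add_mul, Finset.sum_add_distrib]
  have ha2 : ∀ x, ∑ y, a x y = c := by
    intro x
    simpa [hQ.row_sum x] using ha1 (fun _ => 1) x
  set U : (E → ℝ) → E → ℝ := fun W x => (∑ y, a x y * W y) / (c + β) with hU
  set T : (E → ℝ) → E → ℝ := fun W x => max (min (U W x) (φ x)) (ψ x) with hT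
  have hUL : ∀ W W' x, |U W x - U W' x| ≤ c / (c + β) * dist W W' := by
    intro W W' x
    have h1 : U W x - U W' x = (∑ y, a x y * (W y - W' y)) / (c + β) := by
      simp only [hU, mul_sub, Finset.sum_sub_distrib, sub_div]
    rw [h1, abs_div, abs_of_pos hcβ, div_mul_eq_mul_div]
    gcongr
    calc |∑ y, a x y * (W y - W' y)| ≤ ∑ y, |a x y * (W y - W' y)| :=
          Finset.abs_sum_le_sum_abs _ _
      _ ≤ ∑ y, a x y * dist W W' := by
          refine Finset.sum_le_sum fun y _ => ?_
          rw [abs_mul, abs_of_nonneg (ha0 x y)]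
          exact mul_le_mul_of_nonneg_left (dist_le_pi_dist W W' y) (ha0 x y)
      _ = c * dist W W' := by rw [← Finset.sum_mul, ha2]
  have hk0 : 0 ≤ c / (c + β) := by positivity
  have hcontr : ContractingWith (c / (c + β)).toNNReal T := by
    constructor
    · rw [← NNReal.coe_lt_coe, Real.coe_toNNReal _ hk0, NNReal.coe_one, div_lt_one hcβ]
      linarith
    · refine LipschitzWith.of_dist_le_mul fun W W' => ?_
      rw [Real.coe_toNNReal _ hk0]
      refine (dist_pi_le_iff (mul_nonneg hk0 dist_nonneg)).2 fun x => ?_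
      refine le_trans ?_ (hUL W W' x)
      refine (abs_max_sub_max_le_abs _ _ _).trans ?_
      refine (abs_min_sub_min_le_max _ _ _ _).trans ?_
      simp
  set V := ContractingWith.fixedPoint T hcontr
  have hV : ∀ x, max (min (U V x) (φ x)) (ψ x) = V x := fun x =>
    congrFun (ContractingWith.fixedPoint_isFixedPt (f := T) hcontr) x
  -- Thus `(U V - V)(c + β) = QV - βV`: the sign conditions compare `V` with `U V`, and the
  -- fixed-point equation settles them wherever an obstacle is inactive.
  have hUV : ∀ x, U V x * (c + β) = ∑ y, Q x y * V y + c * V x := by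
    intro x
    rw [← ha1]; simp only [hU]; field_simp
  refine ⟨V, fun x => ?_, fun x => ?_, fun x hx => ?_, fun x hx => ?_⟩
  · rw [← hV x]; exact le_max_right _ _
  · rw [← hV x]; exact max_le (min_le_right _ _) (hψφ x)
  · have : U V x ≤ V x := by
      rcases le_total (U V x) (φ x) with h | h
      · rw [← min_eq_left h]; exact (le_max_left _ _).trans (hV x).le
      · have h2 := hV x
        rw [min_eq_right h] at h2
        exact absurd ((le_max_left _ _).trans h2.le) (not_le.2 hx)
    nlinarith [hUV x]
  · have : V x ≤ U V x := by
      have h2 := hV x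
      rcases le_total (min (U V x) (φ x)) (ψ x) with h | h
      · rw [max_eq_right h] at h2
        exact absurd h2 hx.ne
      · rw [max_eq_left h] at h2
        rw [← h2]; exact min_le_left _ _
    nlinarith [hUV x]

end IsMarkovGenerator

namespace MarkovChain

variable {E Ω : Type*} [Fintype E] [MeasurableSpace E] [DiscreteMeasurableSpace E]
  [mΩ : MeasurableSpace Ω] (M : MarkovChain E Ω)

attribute [local instance] isProbabilityMeasure_P

/-! ### Hitting times of right-continuous paths. -/

section Hitting

/-- The infimum is attained: visits to `A` occur at or arbitrarily soon after it, while the path is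
constant just after it. -/
theorem X_untopD_hit_mem {A : Set E} {ω : Ω} (h : M.hit A ω ≠ ⊤) :
    M.X ((M.hit A ω).untopD 0) ω ∈ A := by
  classical
  have hex : ∃ j : ℝ≥0, 0 ≤ j ∧ M.X j ω ∈ A := by
    by_contra hne
    exact h (by simp only [hit, hittingAfter, if_neg hne])
  have hhit : M.hit A ω = ((sInf {i : ℝ≥0 | 0 ≤ i ∧ M.X i ω ∈ A} : ℝ≥0) : WithTop ℝ≥0) := by
    simp only [hit, hittingAfter, if_pos hex]
  rw [hhit, WithTop.untopD_coe]
  have hglb := isGLB_csInf (s := {i : ℝ≥0 | 0 ≤ i ∧ M.X i ω ∈ A}) hex (OrderBot.bddBelow _)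
  obtain ⟨s, hs, hXs⟩ := ((hglb.frequently_mem hex).and_eventually
    (M.rightContinuous ω _)).exists
  exact hXs ▸ hs.2

theorem hit_le_iff {A : Set E} {ω : Ω} {t : ℝ≥0} :
    M.hit A ω ≤ t ↔ ∃ s ≤ t, M.X s ω ∈ A := by
  constructor
  · intro h
    have hne : M.hit A ω ≠ ⊤ := ne_top_of_le_ne_top WithTop.coe_ne_top h
    refine ⟨_, ?_, M.X_untopD_hit_mem hne⟩
    obtain ⟨s, hs⟩ := WithTop.ne_top_iff_exists.1 hne
    rw [← hs] at h ⊢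
    exact WithTop.coe_le_coe.1 h
  · rintro ⟨s, hst, hs⟩
    by_contra h
    exact notMem_of_lt_hittingAfter ((WithTop.coe_le_coe.2 hst).trans_lt (not_le.1 h))
      (zero_le) hs

theorem notMem_of_lt_hit {A : Set E} {ω : Ω} {t : ℝ≥0} (h : (t : WithTop ℝ≥0) < M.hit A ω) :
    M.X t ω ∉ A :=
  notMem_of_lt_hittingAfter h (zero_le)

theorem measurableSet_filtration_X {s t : ℝ≥0} (h : s ≤ t) (A : Set E) :
    MeasurableSet[M.filtration t] {ω | M.X s ω ∈ A} :=
  (le_iSup₂ (f := fun s (_ : s ≤ t) => MeasurableSpace.comap (M.X s) inferInstance) s h) _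
    ⟨A, MeasurableSet.of_discrete, rfl⟩

/-- A visit to `A` before `t` lasts for a nondegenerate interval, so a countable dense set of times
up to `t`, together with `t` itself, detects it. No augmentation of the filtration is needed. -/
theorem isStoppingTime_hit (A : Set E) : IsStoppingTime M.filtration (M.hit A) := by
  intro t
  obtain ⟨D, hDc, hDd⟩ := TopologicalSpace.exists_countable_dense ℝ≥0
  have hset : {ω | M.hit A ω ≤ t} =
      {ω | M.X t ω ∈ A} ∪ ⋃ q ∈ D ∩ Iic t, {ω | M.X q ω ∈ A} := by
    ext ω
    simp only [mem_ofPred_eq, hit_le_iff, mem_union, mem_iUnion, exists_prop, mem_inter_iff,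
      mem_Iic]
    constructor
    · rintro ⟨s, hst, hs⟩
      rcases hst.eq_or_lt with rfl | hlt
      · exact Or.inl hs
      obtain ⟨u, hu, hsub⟩ := (mem_nhdsGE_iff_exists_Ico_subset' hlt).1 (M.rightContinuous ω s)
      obtain ⟨q, hqD, hsq, hq⟩ := hDd.exists_between (lt_min hu hlt)
      have : M.X q ω = M.X s ω := hsub ⟨hsq.le, hq.trans_le (min_le_left _ _)⟩
      exact Or.inr ⟨q, ⟨hqD, (hq.trans_le (min_le_right _ _)).le⟩, this ▸ hs⟩
    · rintro (h | ⟨q, ⟨_, hq⟩, h⟩)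
      · exact ⟨t, le_rfl, h⟩
      · exact ⟨q, hq, h⟩
  rw [hset]
  exact (M.measurableSet_filtration_X le_rfl A).union
    (MeasurableSet.biUnion (hDc.mono inter_subset_left)
      fun q hq => M.measurableSet_filtration_X hq.2 A)

theorem hit_eq_zero {A : Set E} {ω : Ω} (h : M.X 0 ω ∈ A) : M.hit A ω = 0 :=
  le_antisymm (M.hit_le_iff.2 ⟨0, le_rfl, h⟩) (zero_le)

theorem hit_pos {A : Set E} {ω : Ω} (h : M.X 0 ω ∉ A) : 0 < M.hit A ω := by
  by_contra h0
  obtain ⟨s, hs, hsA⟩ := M.hit_le_iff.1 (not_lt.1 h0)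
  exact h (le_antisymm hs (zero_le) ▸ hsA)

end Hitting

theorem ae_X_zero (x : E) : ∀ᵐ ω ∂(M.P x), M.X 0 ω = x := by
  have : MeasurableSet {ω | M.X 0 ω = x} :=
    M.measurable_X 0 (MeasurableSet.of_discrete (s := {x}))
  exact (prob_compl_eq_zero_iff this).2 (M.initial x)

section Discounted

variable {β : ℝ} {f g : E → ℝ} {η η' : Ω → WithTop ℝ≥0} {ω : Ω}

theorem discounted_congr (h : η ω = η' ω) : M.discounted β f η ω = M.discounted β f η' ω := by
  simp only [discounted, h]

theorem discounted_mono
    (h : η ω ≠ ⊤ → f (M.X ((η ω).untopD 0) ω) ≤ g (M.X ((η ω).untopD 0) ω)) :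
    M.discounted β f η ω ≤ M.discounted β g η ω := by
  by_cases ht : η ω = ⊤
  · simp [discounted, ht]
  · simp only [discounted, if_neg ht]
    exact mul_le_mul_of_nonneg_left (h ht) (Real.exp_pos _).le

theorem discounted_neg : M.discounted β (fun x => -f x) η ω = -M.discounted β f η ω := by
  by_cases ht : η ω = ⊤ <;> simp [discounted, ht]

omit [MeasurableSpace E] [DiscreteMeasurableSpace E] in
theorem abs_exp_mul_le (hβ : 0 < β) (f : E → ℝ) (t : ℝ≥0) (y : E) :
    |Real.exp (-β * t) * f y| ≤ ∑ z, |f z| := by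
  have h1 : Real.exp (-β * t) ≤ 1 := Real.exp_le_one_iff.2 (by nlinarith [t.coe_nonneg])
  have h2 : |f y| ≤ ∑ z, |f z| :=
    Finset.single_le_sum (f := fun z => |f z|) (fun _ _ => abs_nonneg _) (Finset.mem_univ y)
  rw [abs_mul, abs_of_pos (Real.exp_pos _)]
  nlinarith [abs_nonneg (f y), Real.exp_pos (-β * t)]

theorem abs_discounted_le (hβ : 0 < β) : |M.discounted β f η ω| ≤ ∑ z, |f z| := by
  by_cases ht : η ω = ⊤
  · simpa [discounted, ht] using Finset.sum_nonneg fun _ _ => abs_nonneg _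
  · simpa only [discounted, if_neg ht] using abs_exp_mul_le hβ f _ _

end Discounted

/-! ### Approximation of stopped payoffs on a grid. -/

section Sampling

/-- `e^{-β t} f(X_t)` sampled at the first time of the grid `{k / (n+1) : k ≤ (n+1)²}` that is not
before `σ` (the last time of the grid if there is none), written as a telescoping sum. -/
noncomputable def sampled (β : ℝ) (f : E → ℝ) (σ : Ω → WithTop ℝ≥0) (n : ℕ) (ω : Ω) : ℝ :=
  f (M.X 0 ω) + ∑ k ∈ Finset.range ((n + 1) ^ 2),
    {ω | ((k * ((n : ℝ≥0) + 1)⁻¹ : ℝ≥0) : WithTop ℝ≥0) < σ ω}.indicator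
      (fun ω => Real.exp (-β * (k * ((n : ℝ≥0) + 1)⁻¹ : ℝ≥0)) *
        (Real.exp (-β * (((n : ℝ≥0) + 1)⁻¹ : ℝ≥0)) *
          f (M.X (k * ((n : ℝ≥0) + 1)⁻¹ + ((n : ℝ≥0) + 1)⁻¹) ω) -
            f (M.X (k * ((n : ℝ≥0) + 1)⁻¹) ω))) ω

variable {β : ℝ} {f : E → ℝ} {σ : Ω → WithTop ℝ≥0}

theorem exists_sampled_eq (β : ℝ) (f : E → ℝ) (σ : Ω → WithTop ℝ≥0) (n : ℕ) (ω : Ω) :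
    ∃ m ≤ (n + 1) ^ 2,
      M.sampled β f σ n ω = Real.exp (-β * (m * ((n : ℝ≥0) + 1)⁻¹ : ℝ≥0)) *
        f (M.X (m * ((n : ℝ≥0) + 1)⁻¹) ω) ∧
      (∀ k < m, ((k * ((n : ℝ≥0) + 1)⁻¹ : ℝ≥0) : WithTop ℝ≥0) < σ ω) ∧
      (m < (n + 1) ^ 2 → σ ω ≤ ((m * ((n : ℝ≥0) + 1)⁻¹ : ℝ≥0) : WithTop ℝ≥0)) := by
  classical
  obtain ⟨m, hm, hsum, h1, h2⟩ := exists_telescope_eq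
    (fun k : ℕ => Real.exp (-β * (k * ((n : ℝ≥0) + 1)⁻¹ : ℝ≥0)) *
        f (M.X (k * ((n : ℝ≥0) + 1)⁻¹) ω))
    (fun k : ℕ => ((k * ((n : ℝ≥0) + 1)⁻¹ : ℝ≥0) : WithTop ℝ≥0) < σ ω)
    (fun k l hkl hl => lt_of_le_of_lt (WithTop.coe_le_coe.2 (by gcongr)) hl) ((n + 1) ^ 2)
  refine ⟨m, hm, ?_, h1, fun h => not_lt.1 (h2 h)⟩
  rw [← hsum]
  simp only [sampled, indicator_apply, mem_ofPred_eq, Nat.cast_zero, zero_mul, NNReal.coe_zero,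
    mul_zero, Real.exp_zero, one_mul]
  congr 1
  refine Finset.sum_congr rfl fun k _ => ?_
  split_ifs
  · have hk : (((k + 1 : ℕ) : ℝ≥0) * ((n : ℝ≥0) + 1)⁻¹) =
        k * ((n : ℝ≥0) + 1)⁻¹ + ((n : ℝ≥0) + 1)⁻¹ := by push_cast; ring
    rw [hk, mul_sub, ← mul_assoc, ← Real.exp_add, NNReal.coe_add, mul_add]
  · rfl

theorem abs_sampled_le (hβ : 0 < β) (n : ℕ) (ω : Ω) :
    |M.sampled β f σ n ω| ≤ ∑ z, |f z| := by
  obtain ⟨m, -, h, -⟩ := M.exists_sampled_eq β f σ n ω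
  rw [h]
  exact abs_exp_mul_le hβ f _ _

/-- If `σ` is finite, the sampling times converge to it and eventually lie at or after it, so
right-continuity applies. If `σ = ∞`, the sampling time is the end `n + 1` of the grid and the
discount forces the limit `0`. -/
theorem tendsto_sampled (hβ : 0 < β) (f : E → ℝ) (σ : Ω → WithTop ℝ≥0) (ω : Ω) :
    Tendsto (fun n => M.sampled β f σ n ω) atTop (𝓝 (M.discounted β f σ ω)) := by
  choose m hmK hm hlt hle using fun n => M.exists_sampled_eq β f σ n ω
  simp only [hm]
  have hinv : Tendsto (fun n : ℕ => ((n : ℝ≥0) + 1)⁻¹) atTop (𝓝 0) := by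
    have := tendsto_one_div_add_atTop_nhds_zero_nat (𝕜 := ℝ≥0)
    simpa using this
  rcases eq_or_ne (σ ω) ⊤ with ht | ht
  · have hm' : ∀ n, m n = (n + 1) ^ 2 := fun n => by
      by_contra hne
      have := hle n (lt_of_le_of_ne (hmK n) hne)
      exact WithTop.coe_ne_top (top_le_iff.1 (ht ▸ this))
    have hval : ∀ n, (m n * ((n : ℝ≥0) + 1)⁻¹ : ℝ≥0) = n + 1 := fun n => by
      rw [hm' n]; push_cast; field_simp
    simp only [hval, discounted, ht, if_true]
    have h0 : Tendsto (fun n : ℕ => Real.exp (-β * ((n + 1 : ℝ≥0) : ℝ)) * ∑ z, |f z|)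
        atTop (𝓝 0) := by
      have : Tendsto (fun n : ℕ => Real.exp (-β * ((n + 1 : ℝ≥0) : ℝ))) atTop (𝓝 0) := by
        refine Real.tendsto_exp_atBot.comp ?_
        refine Tendsto.const_mul_atTop_of_neg (by linarith) ?_
        push_cast
        exact tendsto_atTop_add_const_right _ _ tendsto_natCast_atTop_atTop
      simpa using this.mul_const (∑ z, |f z|)
    refine squeeze_zero_norm (fun n => ?_) h0
    rw [norm_mul, Real.norm_eq_abs, abs_of_pos (Real.exp_pos _)]
    exact mul_le_mul_of_nonneg_left (Finset.single_le_sum (f := fun z => |f z|)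
      (fun _ _ => abs_nonneg _) (Finset.mem_univ _)) (Real.exp_pos _).le
  · obtain ⟨s, hs⟩ := WithTop.ne_top_iff_exists.1 ht
    have hD : M.discounted β f σ ω = Real.exp (-β * s) * f (M.X s ω) := by
      rw [discounted, if_neg ht, ← hs, WithTop.untopD_coe]
    rw [hD]
    simp only [← hs, WithTop.coe_lt_coe, WithTop.coe_le_coe] at hlt hle
    have hup : ∀ n, (m n * ((n : ℝ≥0) + 1)⁻¹ : ℝ≥0) ≤ s + ((n : ℝ≥0) + 1)⁻¹ := fun n => by
      rcases Nat.eq_zero_or_pos (m n) with h0 | h0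
      · rw [h0]; simp
      · obtain ⟨k, hk⟩ := Nat.exists_eq_succ_of_ne_zero h0.ne'
        have := hlt n k (by omega)
        rw [hk, Nat.succ_eq_add_one, Nat.cast_add, Nat.cast_one, add_mul, one_mul]
        gcongr
    have hlow : ∀ᶠ n : ℕ in atTop, s ≤ (m n * ((n : ℝ≥0) + 1)⁻¹ : ℝ≥0) := by
      filter_upwards [eventually_ge_atTop ⌈s⌉₊] with n hn
      rcases (hmK n).lt_or_eq with h | h
      · exact hle n h
      · have hval : (m n * ((n : ℝ≥0) + 1)⁻¹ : ℝ≥0) = n + 1 := by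
          rw [h]; push_cast; field_simp
        rw [hval]
        exact (Nat.ceil_le.1 hn).trans (by simp)
    have htend : Tendsto (fun n => (m n * ((n : ℝ≥0) + 1)⁻¹ : ℝ≥0)) atTop (𝓝 s) := by
      refine tendsto_of_tendsto_of_tendsto_of_le_of_le' tendsto_const_nhds ?_ hlow
        (Eventually.of_forall hup)
      simpa using hinv.const_add s
    have hwithin : Tendsto (fun n => (m n * ((n : ℝ≥0) + 1)⁻¹ : ℝ≥0)) atTop (𝓝[≥] s) :=
      tendsto_nhdsWithin_iff.2 ⟨htend, hlow⟩
    have hcont : Tendsto (fun n => Real.exp (-β * (m n * ((n : ℝ≥0) + 1)⁻¹ : ℝ≥0)) *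
        f (M.X s ω)) atTop (𝓝 (Real.exp (-β * s) * f (M.X s ω))) := by
      have hc : Continuous fun t : ℝ≥0 => Real.exp (-β * t) * f (M.X s ω) := by fun_prop
      exact (hc.tendsto s).comp htend
    refine hcont.congr' ?_
    filter_upwards [hwithin.eventually (M.rightContinuous ω s)] with n hn
    rw [hn]

theorem measurable_comp_X (f : E → ℝ) (t : ℝ≥0) : Measurable fun ω => f (M.X t ω) :=
  (Measurable.of_discrete (f := f)).comp (M.measurable_X t)

theorem measurableSet_lt_of_isStoppingTime (hσ : IsStoppingTime M.filtration σ) (t : ℝ≥0) :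
    MeasurableSet {ω | (t : WithTop ℝ≥0) < σ ω} :=
  M.filtration.le t _ (hσ.measurableSet_gt t)

theorem measurable_sampled (β : ℝ) (f : E → ℝ) (hσ : IsStoppingTime M.filtration σ) (n : ℕ) :
    Measurable (M.sampled β f σ n) := by
  refine (M.measurable_comp_X f 0).add (Finset.measurable_fun_sum _ fun k _ => ?_)
  refine Measurable.indicator ?_ (M.measurableSet_lt_of_isStoppingTime hσ _)
  exact (((M.measurable_comp_X f _).const_mul _).sub (M.measurable_comp_X f _)).const_mul _

theorem measurable_discounted (hβ : 0 < β) (f : E → ℝ) (hσ : IsStoppingTime M.filtration σ) :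
    Measurable (M.discounted β f σ) :=
  measurable_of_tendsto_metrizable (M.measurable_sampled β f hσ)
    (tendsto_pi_nhds.2 fun ω => M.tendsto_sampled hβ f σ ω)

theorem integrable_discounted (hβ : 0 < β) (f : E → ℝ) (hσ : IsStoppingTime M.filtration σ)
    (x : E) : Integrable (M.discounted β f σ) (M.P x) :=
  Integrable.of_bound (M.measurable_discounted hβ f hσ).aestronglyMeasurable (∑ z, |f z|)
    (Eventually.of_forall fun _ => M.abs_discounted_le hβ)

end Sampling

/-! ### Discounted optional stopping. -/

section Expectation

variable {β : ℝ} {f : E → ℝ} {σ : Ω → WithTop ℝ≥0}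

theorem integrable_comp_X (f : E → ℝ) (t : ℝ≥0) (x : E) :
    Integrable (fun ω => f (M.X t ω)) (M.P x) :=
  Integrable.of_bound (M.measurable_comp_X f t).aestronglyMeasurable (∑ z, |f z|)
    (Eventually.of_forall fun ω => Finset.single_le_sum (f := fun z => |f z|)
      (fun _ _ => abs_nonneg _) (Finset.mem_univ (M.X t ω)))

theorem setIntegral_comp_X (f : E → ℝ) (t : ℝ≥0) (B : Set Ω) (x : E) :
    ∫ ω in B, f (M.X t ω) ∂(M.P x) = ∑ z, f z * (M.P x).real (B ∩ {ω | M.X t ω = z}) := by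
  classical
  have hm : ∀ z, MeasurableSet {ω | M.X t ω = z} := fun z =>
    M.measurable_X t (MeasurableSet.of_discrete (s := {z}))
  have h1 : ∀ ω, f (M.X t ω) = ∑ z, {ω | M.X t ω = z}.indicator (fun _ => f z) ω := fun ω => by
    simp [indicator_apply]
  simp only [h1]
  rw [integral_finsetSum _ fun z _ => (integrable_const (f z)).indicator (hm z)]
  refine Finset.sum_congr rfl fun z _ => ?_
  rw [setIntegral_indicator (hm z), setIntegral_const, smul_eq_mul, mul_comm]

theorem markov_real (x : E) (s t : ℝ≥0) {B : Set Ω} (hB : MeasurableSet[M.filtration s] B)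
    (y : E) : (M.P x).real (B ∩ {ω | M.X (s + t) ω = y}) =
      ∑ z, (M.P x).real (B ∩ {ω | M.X s ω = z}) * (M.P z).real {ω | M.X t ω = y} := by
  simp only [measureReal_def]
  rw [M.markov x s t B hB y, ENNReal.toReal_sum fun z _ =>
    ENNReal.mul_ne_top (measure_ne_top _ _) (measure_ne_top _ _)]
  simp only [ENNReal.toReal_mul]

theorem setIntegral_increment (f : E → ℝ) (a : ℝ) (s t : ℝ≥0) {B : Set Ω}
    (hB : MeasurableSet[M.filtration s] B) (x : E) :
    ∫ ω in B, (a * f (M.X (s + t) ω) - f (M.X s ω)) ∂(M.P x) =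
      ∑ z, (M.P x).real (B ∩ {ω | M.X s ω = z}) *
        (a * ∑ y, (M.P z).real {ω | M.X t ω = y} * f y - f z) := by
  have hi := fun t => (M.integrable_comp_X f t x).integrableOn (s := B)
  rw [integral_sub ((hi _).const_mul a) (hi _), integral_const_mul,
    M.setIntegral_comp_X f, M.setIntegral_comp_X f]
  simp only [M.markov_real x s t hB, mul_sub, Finset.sum_sub_distrib, Finset.mul_sum]
  rw [Finset.sum_comm]
  congr 1
  · exact Finset.sum_congr rfl fun z _ => Finset.sum_congr rfl fun y _ => by ring
  · exact Finset.sum_congr rfl fun z _ => mul_comm _ _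

/-- Where `Q f - β f ≤ 0`, the discounted semigroup does not increase `f` to first order. -/
theorem eventually_discounted_transition_le (β : ℝ) (f : E → ℝ) {ε : ℝ} (hε : 0 < ε) {z : E}
    (hz : ∑ y, M.Q z y * f y - β * f z ≤ 0) :
    ∀ᶠ t in 𝓝[≥] (0 : ℝ),
      Real.exp (-β * t) * ∑ y, (M.P z).real {ω | M.X t.toNNReal ω = y} * f y - f z ≤ ε * t := by
  classical
  have hp : ∑ y, (M.P z).real {ω | M.X 0 ω = y} * f y = f z := by
    have h := M.setIntegral_comp_X f 0 univ z
    simp only [univ_inter, Measure.restrict_univ] at h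
    rw [integral_congr_ae ((M.ae_X_zero z).mono fun ω hω => by
      show f (M.X 0 ω) = f z
      rw [hω])] at h
    rw [integral_const, probReal_univ, one_smul] at h
    simp only [h, mul_comm]
  have hsum : HasDerivWithinAt
      (fun t : ℝ => ∑ y, (M.P z).real {ω | M.X t.toNNReal ω = y} * f y)
      (∑ y, M.Q z y * f y) (Ici 0) 0 :=
    HasDerivWithinAt.fun_sum fun y _ => (M.generator z y).mul_const (f y)
  have hexp : HasDerivWithinAt (fun t : ℝ => Real.exp (-β * t)) (-β) (Ici 0) 0 := by
    have := ((hasDerivAt_id (0 : ℝ)).const_mul (-β)).exp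
    simpa using this.hasDerivWithinAt
  have hprod := hexp.fun_mul hsum
  simp only [mul_zero, Real.exp_zero, Real.toNNReal_zero, hp, one_mul] at hprod
  have := eventually_sub_le_of_hasDerivWithinAt_nonpos hprod (by linarith) hε
  simpa only [mul_zero, Real.exp_zero, Real.toNNReal_zero, hp, one_mul] using this

/-- The event `{kh < σ}` is known at time `kh`, so the Markov property applies to each increment; on
it the chain is outside `A`, so only states satisfying the one-step bound carry weight. -/
theorem integral_sampled_le {A : Set E} {ε : ℝ} (hβ : 0 < β) (hε : 0 ≤ ε)
    (hσ : IsStoppingTime M.filtration σ) (hA : ∀ ω, σ ω ≤ M.hit A ω) (n : ℕ)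
    (hn : ∀ z ∉ A, Real.exp (-β * (((n : ℝ≥0) + 1)⁻¹ : ℝ≥0)) *
      ∑ y, (M.P z).real {ω | M.X ((n : ℝ≥0) + 1)⁻¹ ω = y} * f y - f z ≤
        ε * (((n : ℝ≥0) + 1)⁻¹ : ℝ≥0)) (x : E) :
    ∫ ω, M.sampled β f σ n ω ∂(M.P x) ≤ f x + ε * ((1 + β) / β) := by
  set h : ℝ≥0 := ((n : ℝ≥0) + 1)⁻¹ with hh
  have hh0 : (0 : ℝ) < h := by rw [hh]; positivity
  have hh1 : (h : ℝ) ≤ 1 := by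
    rw [hh, NNReal.coe_inv]
    exact inv_le_one_of_one_le₀ (by push_cast; linarith [n.cast_nonneg (α := ℝ)])
  have hi := fun t => M.integrable_comp_X f t x
  have hB : ∀ k : ℕ, MeasurableSet[M.filtration (k * h)]
      {ω | ((k * h : ℝ≥0) : WithTop ℝ≥0) < σ ω} := fun k => hσ.measurableSet_gt _
  have hBm := fun k : ℕ => M.filtration.le _ _ (hB k)
  have hterm : ∀ k : ℕ, ∫ ω, {ω | ((k * h : ℝ≥0) : WithTop ℝ≥0) < σ ω}.indicator
      (fun ω => Real.exp (-β * (k * h : ℝ≥0)) *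
        (Real.exp (-β * h) * f (M.X (k * h + h) ω) - f (M.X (k * h) ω))) ω ∂(M.P x) ≤
      ε * (Real.exp (-β * (k * h)) * h) := by
    intro k
    rw [integral_indicator (hBm k), integral_const_mul, M.setIntegral_increment f _ _ _ (hB k)]
    have : ∑ z, (M.P x).real ({ω | ((k * h : ℝ≥0) : WithTop ℝ≥0) < σ ω} ∩
          {ω | M.X (k * h) ω = z}) * (Real.exp (-β * h) *
          ∑ y, (M.P z).real {ω | M.X h ω = y} * f y - f z) ≤ ε * h := by
      calc _ ≤ ∑ z, (M.P x).real ({ω | ((k * h : ℝ≥0) : WithTop ℝ≥0) < σ ω} ∩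
          {ω | M.X (k * h) ω = z}) * (ε * h) := by
            refine Finset.sum_le_sum fun z _ => ?_
            by_cases hz : z ∈ A
            · have : {ω | ((k * h : ℝ≥0) : WithTop ℝ≥0) < σ ω} ∩
                  {ω | M.X (k * h) ω = z} = ∅ := by
                refine eq_empty_of_forall_notMem fun ω hω => ?_
                refine M.notMem_of_lt_hit (lt_of_lt_of_le hω.1 (hA ω)) ?_
                rw [hω.2]
                exact hz
              rw [this, measureReal_empty, zero_mul, zero_mul]
            · exact mul_le_mul_of_nonneg_left (hn z hz) measureReal_nonneg
        _ = (∑ z, 1 * (M.P x).real ({ω | ((k * h : ℝ≥0) : WithTop ℝ≥0) < σ ω} ∩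
          {ω | M.X (k * h) ω = z})) * (ε * h) := by simp only [one_mul, Finset.sum_mul]
        _ ≤ 1 * (ε * h) := by
            rw [← M.setIntegral_comp_X (fun _ => 1)]
            refine mul_le_mul_of_nonneg_right ?_ (by positivity)
            rw [setIntegral_const, smul_eq_mul, mul_one]
            exact measureReal_le_one
        _ = ε * h := one_mul _
    rw [NNReal.coe_mul, NNReal.coe_natCast]
    nlinarith [mul_le_mul_of_nonneg_left this (Real.exp_pos (-β * (k * h))).le]
  have hint : ∀ k : ℕ, Integrable ({ω | ((k * h : ℝ≥0) : WithTop ℝ≥0) < σ ω}.indicator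
      (fun ω => Real.exp (-β * (k * h : ℝ≥0)) *
        (Real.exp (-β * h) * f (M.X (k * h + h) ω) - f (M.X (k * h) ω)))) (M.P x) := fun k =>
    ((((hi _).const_mul _).sub (hi _)).const_mul _).indicator (hBm k)
  simp only [sampled, ← hh]
  rw [integral_add (hi 0) (integrable_finsetSum _ fun k _ => hint k),
    integral_finsetSum _ fun k _ => hint k]
  refine add_le_add ?_ ?_
  · rw [integral_congr_ae ((M.ae_X_zero x).mono fun ω hω => by
      show f (M.X 0 ω) = f x
      rw [hω])]
    simp
  · refine (Finset.sum_le_sum fun k _ => hterm k).trans ?_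
    rw [← Finset.mul_sum]
    exact mul_le_mul_of_nonneg_left (sum_exp_mul_le hβ hh0 hh1 _) hε

/-- Optional stopping: if `Q f - β f ≤ 0` off `A`, then `e^{-β t} f(X_t)` is a supermartingale up
to the hitting time of `A`. -/
theorem integral_discounted_le {A : Set E} (hβ : 0 < β)
    (hf : ∀ z ∉ A, ∑ y, M.Q z y * f y - β * f z ≤ 0)
    (hσ : IsStoppingTime M.filtration σ) (hA : ∀ ω, σ ω ≤ M.hit A ω) (x : E) :
    ∫ ω, M.discounted β f σ ω ∂(M.P x) ≤ f x := by
  have hlim : Tendsto (fun n => ∫ ω, M.sampled β f σ n ω ∂(M.P x)) atTop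
      (𝓝 (∫ ω, M.discounted β f σ ω ∂(M.P x))) :=
    tendsto_integral_of_dominated_convergence (fun _ => ∑ z, |f z|)
      (fun n => (M.measurable_sampled β f hσ n).aestronglyMeasurable) (integrable_const _)
      (fun n => Eventually.of_forall fun ω => M.abs_sampled_le hβ n ω)
      (Eventually.of_forall fun ω => M.tendsto_sampled hβ f σ ω)
  have hstep : Tendsto (fun n : ℕ => ((((n : ℝ≥0) + 1)⁻¹ : ℝ≥0) : ℝ)) atTop (𝓝[≥] 0) := by
    refine tendsto_nhdsWithin_iff.2 ⟨?_, Eventually.of_forall fun n => NNReal.coe_nonneg _⟩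
    have := tendsto_one_div_add_atTop_nhds_zero_nat (𝕜 := ℝ)
    simpa using this
  have hC : 0 < (1 + β) / β := by positivity
  refine le_of_forall_pos_le_add fun δ hδ => le_of_tendsto hlim ?_
  -- Chosen so that the accumulated error is exactly `δ`. Finiteness of `E` then gives one
  -- small-time bound valid for all states off `A`.
  have hε : 0 < δ / ((1 + β) / β) := div_pos hδ hC
  have hev : ∀ᶠ t in 𝓝[≥] (0 : ℝ), ∀ z, z ∉ A →
      Real.exp (-β * t) * ∑ y, (M.P z).real {ω | M.X t.toNNReal ω = y} * f y - f z ≤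
        δ / ((1 + β) / β) * t := by
    refine eventually_all.2 fun z => ?_
    by_cases hz : z ∈ A
    · exact Eventually.of_forall fun _ h => absurd hz h
    · exact (M.eventually_discounted_transition_le β f hε (hf z hz)).mono fun _ h _ => h
  filter_upwards [hstep.eventually hev] with n hn
  simp only [Real.toNNReal_coe] at hn
  have := M.integral_sampled_le hβ hε.le hσ hA n hn x
  rwa [div_mul_cancel₀ _ hC.ne'] at this

theorem le_integral_discounted {A : Set E} (hβ : 0 < β)
    (hf : ∀ z ∉ A, 0 ≤ ∑ y, M.Q z y * f y - β * f z)
    (hσ : IsStoppingTime M.filtration σ) (hA : ∀ ω, σ ω ≤ M.hit A ω) (x : E) :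
    f x ≤ ∫ ω, M.discounted β f σ ω ∂(M.P x) := by
  have := M.integral_discounted_le (f := fun y => -f y) hβ (fun z hz => by
    simpa only [mul_neg, Finset.sum_neg_distrib, sub_neg_eq_add, neg_add_eq_sub, sub_nonpos]
      using sub_nonneg.1 (hf z hz)) hσ hA x
  simp only [discounted_neg, integral_neg] at this
  linarith

end Expectation

/-! ### Verification for the game. -/

section Game

variable {β : ℝ} {ψ φ V : E → ℝ} {τ γ : Ω → WithTop ℝ≥0}

open Classical in
theorem integrable_payoff (hβ : 0 < β) (ψ φ : E → ℝ) (hτ : IsStoppingTime M.filtration τ)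
    (hγ : IsStoppingTime M.filtration γ) (x : E) :
    Integrable (fun ω => if τ ω ≤ γ ω then M.discounted β ψ τ ω else M.discounted β φ γ ω)
      (M.P x) := by
  have hle : MeasurableSet {ω | τ ω ≤ γ ω} :=
    hγ.measurableSpace_le _ (hτ.measurableSet_stopping_time_le hγ)
  refine (Integrable.piecewise hle (M.integrable_discounted hβ ψ hτ x).integrableOn
    (M.integrable_discounted hβ φ hγ x).integrableOn).congr (Eventually.of_forall fun ω => ?_)
  by_cases h : τ ω ≤ γ ω <;> simp [piecewise, h]

theorem abs_payoff_le (hβ : 0 < β) (ψ φ : E → ℝ) (x : E) (τ γ : Ω → WithTop ℝ≥0) :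
    |M.payoff β ψ φ x τ γ| ≤ ∑ z, |ψ z| + ∑ z, |φ z| := by
  have h1 : 0 ≤ ∑ z, |ψ z| := Finset.sum_nonneg fun _ _ => abs_nonneg _
  have h2 : 0 ≤ ∑ z, |φ z| := Finset.sum_nonneg fun _ _ => abs_nonneg _
  rw [payoff, ← Real.norm_eq_abs]
  refine (norm_integral_le_of_norm_le_const (C := ∑ z, |ψ z| + ∑ z, |φ z|)
    (Eventually.of_forall fun ω => ?_)).trans (by rw [probReal_univ, mul_one])
  rw [Real.norm_eq_abs]
  split_ifs
  · exact (M.abs_discounted_le hβ).trans (by linarith)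
  · exact (M.abs_discounted_le hβ).trans (by linarith)

/-- Stopping at the hitting time of a set where `φ ≤ V`, and off which `Q V - β V ≤ 0`, limits the
loss of the minimizer to `V`. -/
theorem payoff_hit_le {A : Set E} (hβ : 0 < β) (hψV : ∀ x, ψ x ≤ V x) (hφV : ∀ x ∈ A, φ x ≤ V x)
    (hV : ∀ z ∉ A, ∑ y, M.Q z y * V y - β * V z ≤ 0) (hτ : IsStoppingTime M.filtration τ)
    (x : E) : M.payoff β ψ φ x τ (M.hit A) ≤ V x := by
  classical
  have hγ := M.isStoppingTime_hit A
  -- Compare pathwise with `V` stopped at the minimum: if `τ` comes first use `ψ ≤ V`, otherwise the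
  -- chain is in `A`, where `φ ≤ V`.
  have hσ := hτ.min hγ
  refine le_trans (integral_mono (M.integrable_payoff hβ ψ φ hτ hγ x)
    (M.integrable_discounted hβ V hσ x) fun ω => ?_)
    (M.integral_discounted_le hβ hV hσ (fun ω => min_le_right _ _) x)
  dsimp only
  split_ifs with h
  · rw [M.discounted_congr (η := fun ω => min (τ ω) (M.hit A ω)) (η' := τ) (min_eq_left h)]
    exact M.discounted_mono fun _ => hψV _
  · rw [M.discounted_congr (η := fun ω => min (τ ω) (M.hit A ω)) (η' := M.hit A)
      (min_eq_right (not_le.1 h).le)]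
    exact M.discounted_mono fun ht => hφV _ (M.X_untopD_hit_mem ht)

/-- Stopping at the hitting time of a set where `V ≤ ψ`, and off which `0 ≤ Q V - β V`, guarantees
`V` to the maximizer. -/
theorem le_payoff_hit {B : Set E} (hβ : 0 < β) (hVφ : ∀ x, V x ≤ φ x) (hVψ : ∀ x ∈ B, V x ≤ ψ x)
    (hV : ∀ z ∉ B, 0 ≤ ∑ y, M.Q z y * V y - β * V z) (hγ : IsStoppingTime M.filtration γ)
    (x : E) : V x ≤ M.payoff β ψ φ x (M.hit B) γ := by
  classical
  have hτ := M.isStoppingTime_hit B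
  have hσ := hτ.min hγ
  refine le_trans (M.le_integral_discounted hβ hV hσ (fun ω => min_le_left _ _) x)
    (integral_mono (M.integrable_discounted hβ V hσ x)
      (M.integrable_payoff hβ ψ φ hτ hγ x) fun ω => ?_)
  dsimp only
  split_ifs with h
  · rw [M.discounted_congr (η := fun ω => min (M.hit B ω) (γ ω)) (η' := M.hit B) (min_eq_left h)]
    exact M.discounted_mono fun ht => hVψ _ (M.X_untopD_hit_mem ht)
  · rw [M.discounted_congr (η := fun ω => min (M.hit B ω) (γ ω)) (η' := γ)
      (min_eq_right (not_le.1 h).le)]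
    exact M.discounted_mono fun _ => hVφ _

theorem isNashEquilibrium_of_le {τ₀ γ₀ : Ω → WithTop ℝ≥0} (hτ₀ : τ₀ ∈ M.stoppingTimes)
    (hγ₀ : γ₀ ∈ M.stoppingTimes)
    (hle : ∀ x, ∀ τ ∈ M.stoppingTimes, M.payoff β ψ φ x τ γ₀ ≤ V x)
    (hge : ∀ x, ∀ γ ∈ M.stoppingTimes, V x ≤ M.payoff β ψ φ x τ₀ γ) :
    M.IsNashEquilibrium β ψ φ τ₀ γ₀ :=
  ⟨hτ₀, hγ₀, fun x τ hτ γ hγ =>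
    ⟨(hle x τ hτ).trans (hge x γ₀ hγ₀), (hle x τ₀ hτ₀).trans (hge x γ hγ)⟩⟩

/-- Both players can guarantee `V`. Payoffs are uniformly bounded, so the real suprema and infima
are genuine rather than default values. -/
theorem isValue_of_le (hβ : 0 < β) {τ₀ γ₀ : Ω → WithTop ℝ≥0} (hτ₀ : τ₀ ∈ M.stoppingTimes)
    (hγ₀ : γ₀ ∈ M.stoppingTimes)
    (hle : ∀ x, ∀ τ ∈ M.stoppingTimes, M.payoff β ψ φ x τ γ₀ ≤ V x)
    (hge : ∀ x, ∀ γ ∈ M.stoppingTimes, V x ≤ M.payoff β ψ φ x τ₀ γ) :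
    M.IsValue β ψ φ V := by
  have : Nonempty M.stoppingTimes := ⟨⟨τ₀, hτ₀⟩⟩
  have hbelow : ∀ x (τ : Ω → WithTop ℝ≥0),
      BddBelow (range fun γ : M.stoppingTimes => M.payoff β ψ φ x τ γ) := fun x τ =>
    ⟨_, by rintro _ ⟨γ, rfl⟩; exact neg_le_of_abs_le (M.abs_payoff_le hβ ψ φ x τ γ)⟩
  have habove : ∀ x (γ : Ω → WithTop ℝ≥0),
      BddAbove (range fun τ : M.stoppingTimes => M.payoff β ψ φ x τ γ) := fun x γ =>
    ⟨_, by rintro _ ⟨τ, rfl⟩; exact le_of_abs_le (M.abs_payoff_le hβ ψ φ x τ γ)⟩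
  have hinf : ∀ x (τ : M.stoppingTimes),
      ⨅ γ : M.stoppingTimes, M.payoff β ψ φ x τ γ ≤ V x := fun x τ =>
    (ciInf_le (hbelow x τ) ⟨γ₀, hγ₀⟩).trans (hle x τ τ.2)
  have hsup : ∀ x (γ : M.stoppingTimes),
      V x ≤ ⨆ τ : M.stoppingTimes, M.payoff β ψ φ x τ γ := fun x γ =>
    (hge x γ γ.2).trans (le_ciSup (habove x γ) ⟨τ₀, hτ₀⟩)
  refine ⟨funext fun x => le_antisymm (ciSup_le (hinf x)) ?_,
    funext fun x => le_antisymm ?_ (le_ciInf (hsup x))⟩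
  · exact le_ciSup_of_le ⟨V x, by rintro _ ⟨τ, rfl⟩; exact hinf x τ⟩ ⟨τ₀, hτ₀⟩
      (le_ciInf fun γ => hge x γ γ.2)
  · exact ciInf_le_of_le ⟨V x, by rintro _ ⟨γ, rfl⟩; exact hsup x γ⟩ ⟨γ₀, hγ₀⟩
      (ciSup_le fun τ => hle x τ τ.2)

end Game

end MarkovChain

/-! ### The game with lowered upper payoff. -/

theorem proposition3p13 {E Ω : Type*} [Fintype E] [MeasurableSpace E] [DiscreteMeasurableSpace E]
    [MeasurableSpace Ω] (M : MarkovChain E Ω) (β : ℝ) (hβ : 0 < β) (ψ φ : E → ℝ)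
    (hψ : ∀ x, 0 ≤ ψ x) (hψφ : ∀ x, ψ x ≤ φ x) :
    ∃ V : E → ℝ, M.IsValue β ψ φ V ∧
      ∀ I : Set E, I ⊆ {x | ψ x < V x ∧ V x < φ x} →
        M.IsValue β ψ (lowerOn I V φ) V ∧
        ((∀ x, ψ x < φ x) →
          M.IsNashEquilibrium β ψ (lowerOn I V φ)
            (M.hit {x | V x = ψ x}) (M.hit {x | V x = φ x}) ∧
          M.IsNashEquilibrium β ψ (lowerOn I V φ)
            (M.hit {x | V x = ψ x}) (M.hit ({x | V x = φ x} ∪ I)) ∧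
          ∀ x ∈ I, ∀ᵐ ω ∂(M.P x),
            M.hit ({x | V x = φ x} ∪ I) ω < M.hit {x | V x = φ x} ω) := by
  obtain ⟨V, hψV, hVφ, hsuper, hsub⟩ := M.isMarkovGenerator.exists_obstacle_solution hβ hψφ
  have hsuper' : ∀ z ∉ {x | V x = φ x}, ∑ y, M.Q z y * V y - β * V z ≤ 0 := fun z hz =>
    hsuper z (lt_of_le_of_ne (hVφ z) hz)
  have hsub' : ∀ z ∉ {x | V x = ψ x}, 0 ≤ ∑ y, M.Q z y * V y - β * V z := fun z hz =>
    hsub z (lt_of_le_of_ne (hψV z) (Ne.symm hz))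
  -- Left general in the upper payoff so as to serve both the original and the lowered game.
  have hge : ∀ φ' : E → ℝ, (∀ x, V x ≤ φ' x) → ∀ x, ∀ γ ∈ M.stoppingTimes,
      V x ≤ M.payoff β ψ φ' x (M.hit {x | V x = ψ x}) γ := fun φ' hφ' x γ hγ =>
    M.le_payoff_hit hβ hφ' (fun _ hx => le_of_eq hx) hsub' hγ x
  refine ⟨V, M.isValue_of_le hβ (M.isStoppingTime_hit _) (M.isStoppingTime_hit {x | V x = φ x})
    (fun x τ hτ => M.payoff_hit_le hβ hψV (fun _ hx => le_of_eq (Eq.symm hx)) hsuper' hτ x)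
    (hge φ hVφ), fun I hI => ?_⟩
  have hVφc : ∀ x, V x ≤ lowerOn I V φ x := fun x => by
    unfold lowerOn
    split_ifs
    exacts [le_rfl, hVφ x]
  have hφcV : ∀ x ∈ {x | V x = φ x} ∪ I, lowerOn I V φ x ≤ V x := fun x hx => by
    unfold lowerOn
    split_ifs with h
    exacts [le_rfl, (hx.resolve_right h).ge]
  have hle₁ : ∀ x, ∀ τ ∈ M.stoppingTimes,
      M.payoff β ψ (lowerOn I V φ) x τ (M.hit {x | V x = φ x}) ≤ V x := fun x τ hτ =>
    M.payoff_hit_le hβ hψV (fun y hy => hφcV y (Or.inl hy)) hsuper' hτ x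
  -- Enlarging the stopping set by `I` only weakens the supermartingale condition required off it.
  have hle₂ : ∀ x, ∀ τ ∈ M.stoppingTimes,
      M.payoff β ψ (lowerOn I V φ) x τ (M.hit ({x | V x = φ x} ∪ I)) ≤ V x := fun x τ hτ =>
    M.payoff_hit_le hβ hψV hφcV (fun z hz => hsuper' z fun h => hz (Or.inl h)) hτ x
  refine ⟨M.isValue_of_le hβ (M.isStoppingTime_hit _) (M.isStoppingTime_hit _) hle₁
    (hge _ hVφc), fun _ => ⟨?_, ?_, fun x hx => ?_⟩⟩
  · exact M.isNashEquilibrium_of_le (M.isStoppingTime_hit _) (M.isStoppingTime_hit _) hle₁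
      (hge _ hVφc)
  · exact M.isNashEquilibrium_of_le (M.isStoppingTime_hit _) (M.isStoppingTime_hit _) hle₂
      (hge _ hVφc)
  -- From `x ∈ I` the larger set is hit at time `0`, whereas `V x < φ x` keeps the start outside `{V
  -- = φ}`.
  · filter_upwards [M.ae_X_zero x] with ω hω
    rw [M.hit_eq_zero (A := {x | V x = φ x} ∪ I) (Or.inr (hω ▸ hx))]
    exact M.hit_pos (hω ▸ (hI hx).2.ne)
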